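/- Consider the following two decision problems on finite simple graphs. **Cubic Bipartite NAE Decomposition Problem.** Instance: a 3-regular bipartite graph $G$. Question: does $G$ have a Not-All-Equal (NAE) decomposition, that is, can the vertex set $V(G)$ be partitioned into two sets such that every vertex of $G$ has at least one neighbour in each of the two sets? **Minimum Edge Deletion Bipartition Problem on 3-regular graphs (decision version).** Instance: a 3-regular graph $G$ and a number $k\in\mathbb{N}$. Question: is the minimum number of edges of $G$ whose removal leads to a bipartite graph at most $k$? **Theorem.** If the Cubic Bipartite NAE Decomposition Problem is $\mathbf{NP}$-complete, then the Minimum Edge Deletion Bipartition Problem on 3-regular graphs is $\mathbf{NP}$-hard: every language in $\mathbf{NP}$ is polynomial-time many-one reducible to it. This holds even when $k$ is written in unary. Consequently, determining the minimum number of edges whose removal makes a given 3-regular graph bipartite is $\mathbf{NP}$-hard. (Graphs are described by their adjacency matrices, $\mathbf{NP}$ is defined by deterministic polynomial-time verifiers with polynomially bounded binary certificates, hardness and completeness refer to polynomial-time many-one reductions, and polynomial time refers to deterministic multi-stack Turing machines.) -/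

import Mathlib

open Turing

/-! ### Decision problems, polynomial-time reductions, NP -/

/-- A decision problem: a type of instances, an (injective) encoding of the instances by words over
a finite alphabet, and the set of yes-instances. -/
structure DecisionProblem where
  /-- the instances -/
  Inst : Type
  /-- the alphabet in which instances are written -/
  Alphabet : Type
  /-- the alphabet is finite -/
  finAlphabet : Finite Alphabet
  /-- the word that describes an instance -/
  encode : Inst → List Alphabet
  /-- different instances have different descriptions -/
  encode_injective : Function.Injective encode
  /-- the yes-instances -/
  yes : Set Inst

/-- A language of binary words as a decision problem: every word is an instance, written as it is,
and the yes-instances are the words of the language. -/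
def DecisionProblem.ofLanguage (L : Language Bool) : DecisionProblem where
  Inst := List Bool
  Alphabet := Bool
  finAlphabet := inferInstance
  encode := id
  encode_injective := Function.injective_id
  yes := {w | w ∈ L}

/-- The description of a pair (instance, binary certificate): the description of the instance
followed by the certificate, over the disjoint union of the two alphabets. -/
def DecisionProblem.encodeWithCertificate (P : DecisionProblem) (x : P.Inst × List Bool) :
    List (P.Alphabet ⊕ Bool) :=
  (P.encode x.1).map Sum.inl ++ x.2.map Sum.inr

/-- Membership in NP: there are a polynomial `p` and a verifier `V`, computed by a deterministic
Turing machine in polynomial time, such that `x` is a yes-instance if and only if `V` accepts `x`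
together with some certificate of length at most `p (|x|)`. -/
def DecisionProblem.InNP (P : DecisionProblem) : Prop :=
  ∃ (p : Polynomial ℕ) (V : P.Inst × List Bool → Bool),
    Nonempty (TM2ComputableInPolyTime P.encodeWithCertificate Computability.encodeBool V) ∧
    ∀ x : P.Inst, x ∈ P.yes ↔
      ∃ c : List Bool, c.length ≤ p.eval (P.encode x).length ∧ V (x, c) = true

/-- Polynomial-time many-one (Karp) reducibility: a map from the instances of `P` to those of `Q`,
computed by a deterministic Turing machine in polynomial time, that preserves and reflects
yes-instances. -/
def DecisionProblem.PolyTimeReducible (P Q : DecisionProblem) : Prop :=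
  ∃ f : P.Inst → Q.Inst,
    Nonempty (TM2ComputableInPolyTime P.encode Q.encode f) ∧
    ∀ x : P.Inst, x ∈ P.yes ↔ f x ∈ Q.yes

/-- NP-hardness: every language in NP is polynomial-time many-one reducible to `P`. -/
def DecisionProblem.NPHard (P : DecisionProblem) : Prop :=
  ∀ L : Language Bool, (DecisionProblem.ofLanguage L).InNP →
    (DecisionProblem.ofLanguage L).PolyTimeReducible P

/-- NP-completeness: membership in NP together with NP-hardness. -/
def DecisionProblem.NPComplete (P : DecisionProblem) : Prop :=
  P.InNP ∧ P.NPHard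

/-! ### Graph notions -/

/-- A total dominating set: every vertex of the graph has a neighbour in `S`. -/
def SimpleGraph.IsTotalDominatingSet {V : Type} (G : SimpleGraph V) (S : Set V) : Prop :=
  ∀ v : V, ∃ u ∈ S, G.Adj v u

/-- A Not-All-Equal decomposition: the vertices are partitioned into two total dominating sets. -/
def SimpleGraph.HasNAEDecomposition {V : Type} (G : SimpleGraph V) : Prop :=
  ∃ A : Set V, G.IsTotalDominatingSet A ∧ G.IsTotalDominatingSet Aᶜ

/-- The minimum number of edges of `G` whose removal leads to a bipartite graph. -/
noncomputable def SimpleGraph.minEdgeDeletionBipartition {V : Type} (G : SimpleGraph V) : ℕ :=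
  sInf {k : ℕ | ∃ s : Finset (Sym2 V),
    (s : Set (Sym2 V)) ⊆ G.edgeSet ∧ (G.deleteEdges (s : Set (Sym2 V))).IsBipartite ∧ s.card = k}

/-- For a finite graph the minimum above exists: it is attained. -/
theorem SimpleGraph.minEdgeDeletionBipartition_attained {V : Type} [Finite V]
    (G : SimpleGraph V) :
    ∃ s : Finset (Sym2 V), (s : Set (Sym2 V)) ⊆ G.edgeSet ∧
      (G.deleteEdges (s : Set (Sym2 V))).IsBipartite ∧
      s.card = G.minEdgeDeletionBipartition := by
  refine Nat.sInf_mem (s := {k : ℕ | ∃ s : Finset (Sym2 V), (s : Set (Sym2 V)) ⊆ G.edgeSet ∧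
    (G.deleteEdges (s : Set (Sym2 V))).IsBipartite ∧ s.card = k}) ?_
  refine ⟨_, (Set.toFinite G.edgeSet).toFinset, by simp, ?_, rfl⟩
  refine ⟨SimpleGraph.Coloring.mk (fun _ => 0) ?_⟩
  intro v w h
  simp at h

/-! ### Finite graphs as instances -/

/-- A finite simple graph, its vertices being numbered `0, …, n - 1`. -/
structure FinGraph where
  /-- the number of vertices -/
  n : ℕ
  /-- the graph -/
  graph : SimpleGraph (Fin n)

open Classical in
/-- A graph is 3-regular. -/
def FinGraph.IsCubic (G : FinGraph) : Prop :=
  G.graph.IsRegularOfDegree 3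

open Classical in
/-- One row of the adjacency matrix, followed by the end-of-row symbol `none`. -/
noncomputable def FinGraph.encodeRow (G : FinGraph) (i : Fin G.n) : List (Option Bool) :=
  (List.finRange G.n).map (fun j => some (decide (G.graph.Adj i j))) ++ [none]

/-- A graph is described by its adjacency matrix, written row by row. -/
noncomputable def FinGraph.encode (G : FinGraph) : List (Option Bool) :=
  (List.finRange G.n).flatMap G.encodeRow

theorem FinGraph.count_none_encode (G : FinGraph) : G.encode.count none = G.n := by
  have h : ∀ l : List (Fin G.n), (l.flatMap G.encodeRow).count none = l.length := by
    intro l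
    induction l with
    | nil => simp
    | cons i l ih =>
      have h0 : (G.encodeRow i).count none = 1 := by
        simp [FinGraph.encodeRow, List.count_append, List.count_eq_zero]
      simp only [List.flatMap_cons, List.count_append, ih, h0, List.length_cons]
      omega
  simpa [FinGraph.encode] using h (List.finRange G.n)

theorem FinGraph.encode_injective : Function.Injective FinGraph.encode := by
  rintro ⟨n, G⟩ ⟨m, H⟩ h
  have hn : n = m := by
    have h1 := FinGraph.count_none_encode ⟨n, G⟩
    have h2 := FinGraph.count_none_encode ⟨m, H⟩
    rw [h] at h1
    exact h1.symm.trans h2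
  subst hn
  have key : ∀ l : List (Fin n),
      l.flatMap (FinGraph.encodeRow ⟨n, G⟩) = l.flatMap (FinGraph.encodeRow ⟨n, H⟩) →
      ∀ i ∈ l, FinGraph.encodeRow ⟨n, G⟩ i = FinGraph.encodeRow ⟨n, H⟩ i := by
    intro l
    induction l with
    | nil => simp
    | cons a l ih =>
      intro hl
      simp only [List.flatMap_cons] at hl
      obtain ⟨h1, h2⟩ := List.append_inj hl (by simp [FinGraph.encodeRow])
      intro i hi
      rcases List.mem_cons.1 hi with rfl | hi
      · exact h1
      · exact ih h2 i hi
  have hG : G = H := by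
    ext i j
    have hi := key _ h i (List.mem_finRange i)
    simp only [FinGraph.encodeRow, List.append_cancel_right_eq] at hi
    have hj := List.map_inj_left.1 hi j (List.mem_finRange j)
    simpa using hj
  subst hG
  rfl

/-! ### The two problems -/

/-- Cubic Bipartite NAE Decomposition Problem. Instance: a 3-regular bipartite graph.
Question: does it have a NAE decomposition? -/
noncomputable def cubicBipartiteNAEDecomposition : DecisionProblem where
  Inst := {G : FinGraph // G.IsCubic ∧ G.graph.IsBipartite}
  Alphabet := Option Bool
  finAlphabet := inferInstance
  encode G := G.1.encode
  encode_injective := FinGraph.encode_injective.comp Subtype.val_injective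
  yes := {G | G.1.graph.HasNAEDecomposition}

/-- The description of a graph together with a number: the adjacency matrix followed by the number
in unary. -/
noncomputable def FinGraph.encodeWithNat (x : FinGraph × ℕ) : List (Option Bool ⊕ Unit) :=
  x.1.encode.map Sum.inl ++ List.replicate x.2 (Sum.inr ())

theorem FinGraph.encodeWithNat_injective : Function.Injective FinGraph.encodeWithNat := by
  rintro ⟨G, k⟩ ⟨H, l⟩ h
  have h1 := congrArg (List.filterMap Sum.getLeft?) h
  have h2 := congrArg (List.countP Sum.isRight) h
  have hf : (Sum.getLeft? ∘ (Sum.inl : Option Bool → Option Bool ⊕ Unit)) = some := rfl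
  have hc : (Sum.isRight ∘ (Sum.inl : Option Bool → Option Bool ⊕ Unit)) = fun _ => false := rfl
  have hG : G.encode = H.encode := by
    simpa [FinGraph.encodeWithNat, List.filterMap_append, List.filterMap_map, hf,
      List.filterMap_replicate] using h1
  have hk : k = l := by
    simpa [FinGraph.encodeWithNat, List.countP_append, List.countP_map, hc,
      List.countP_replicate] using h2
  exact Prod.ext (FinGraph.encode_injective hG) hk

/-- The Minimum Edge Deletion Bipartition Problem on 3-regular graphs, in its decision form.
Instance: a 3-regular graph and a number `k` (in unary; hardness in this form is at least as
strong as hardness with `k` in binary). Question: is the minimum number of edges whose removal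
leads to a bipartite graph at most `k`? -/
noncomputable def cubicMinEdgeDeletionBipartition : DecisionProblem where
  Inst := {G : FinGraph // G.IsCubic} × ℕ
  Alphabet := Option Bool ⊕ Unit
  finAlphabet := inferInstance
  encode x := FinGraph.encodeWithNat (x.1.1, x.2)
  encode_injective := by
    intro x y h
    have h' := FinGraph.encodeWithNat_injective h
    exact Prod.ext (Subtype.ext (congrArg Prod.fst h')) (Prod.mk.inj h').2
  yes := {x | x.1.1.graph.minEdgeDeletionBipartition ≤ x.2}

/-! Combinatorial core. In a 3-regular graph `G` on n vertices, give each vertex v a centre `(v, 0)`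
and a triangle whose three corners correspond to the neighbours u of v, each corner being joined to
the centre `(u, 0)`. The result is again 3-regular. Its n triangles are edge-disjoint odd cycles, so
at least n edges must be deleted. If n edges suffice, they are one edge from each triangle and
nothing else. In a 2-colouring of what remains, every corner then has the colour opposite to the
centre it is joined to, and the corners of a triangle are not all alike, since only one of its edges
is gone. Hence the neighbours of each v have centres of both colours: the colour classes of the
centres form a NAE decomposition. The same colouring read backwards gives the converse. These
directions are `hasNAEDecomposition_of_le` and `le_of_hasNAEDecomposition`; the threshold is k = n.

Complexity. A reduction from a language in NP to the NAE problem is followed by the triangle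
construction. Moving the output of one machine onto the input stack of another reverses it, so
`comp_of_reverse` asks the second machine to work on reversed input. Such a machine is given
explicitly and runs in linear time. It meets rows and columns in decreasing order. With neighbours
numbered in decreasing order too, the number of w at v and the number of v at w are running counts
along a row and a column, so one bounded record per column is all the memory needed
(`scan_columns`). -/

/-! ### Runs of a transition function -/

/-- `ReachesIn f t a b`: exactly `t` iterations of the partial function `f` lead from `a` to `b`. -/
inductive ReachesIn {C : Type*} (f : C → Option C) : ℕ → C → C → Prop
  | refl (a : C) : ReachesIn f 0 a a
  | head {t : ℕ} {a b c : C} : f a = some b → ReachesIn f t b c → ReachesIn f (t + 1) a c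

namespace ReachesIn

variable {C D : Type*} {f : C → Option C} {g : D → Option D}

theorem single {a b : C} (h : f a = some b) : ReachesIn f 1 a b :=
  .head h (.refl b)

theorem trans {s t : ℕ} {a b c : C} (h₁ : ReachesIn f s a b) (h₂ : ReachesIn f t b c) :
    ReachesIn f (s + t) a c := by
  induction h₁ with
  | refl => simpa using h₂
  | head h _ ih => rw [Nat.add_right_comm]; exact .head h (ih h₂)

/-- A simulation of `f` by `g` carries runs to runs. -/
theorem map {φ : C → D} (hφ : ∀ a b, f a = some b → g (φ a) = some (φ b)) {t : ℕ} {a b : C}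
    (h : ReachesIn f t a b) : ReachesIn g t (φ a) (φ b) := by
  induction h with
  | refl => exact .refl _
  | head h _ ih => exact .head (hφ _ _ h) ih

/-- Translates to and from the iterated `flip bind` by which `EvalsTo` counts the steps of a
machine. -/
theorem iff_iterate {t : ℕ} {a b : C} :
    ReachesIn f t a b ↔ (flip bind f)^[t] (some a) = some b := by
  have hnone : ∀ t : ℕ, (flip bind f)^[t] none = none := fun t =>
    Function.iterate_fixed rfl t
  constructor
  · intro h
    induction h with
    | refl => rfl
    | head h _ ih =>
      rw [Function.iterate_succ_apply]
      simpa [flip, h] using ih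
  · intro h
    induction t generalizing a with
    | zero => simp only [Function.iterate_zero, id_eq, Option.some.injEq] at h; exact h ▸ .refl a
    | succ t ih =>
      rw [Function.iterate_succ_apply] at h
      cases hc : f a with
      | none =>
        have : (flip bind f) (some a) = none := by simp [flip, hc]
        rw [this, hnone] at h
        cases h
      | some c =>
        have : (flip bind f) (some a) = some c := by simp [flip, hc]
        rw [this] at h
        exact .head hc (ih h)

/-- A quantity that grows by at most `c` in each step grows by at most `c * t` in `t` steps. -/
theorem le_add_mul {μ : C → ℕ} {c : ℕ} (hμ : ∀ a b, f a = some b → μ b ≤ μ a + c) {t : ℕ}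
    {a b : C} (h : ReachesIn f t a b) : μ b ≤ μ a + c * t := by
  induction h with
  | refl => simp
  | head h _ ih => have := hμ _ _ h; rw [Nat.mul_succ]; omega

end ReachesIn

/-- Natural coefficients make evaluation monotone. This lets a time bound be evaluated at an upper
bound for the length of an intermediate word. -/
theorem Polynomial.eval_le_eval_of_le (p : Polynomial ℕ) {m n : ℕ} (h : m ≤ n) :
    p.eval m ≤ p.eval n := by
  rw [Polynomial.eval_eq_sum, Polynomial.eval_eq_sum]
  exact Finset.sum_le_sum fun i _ => Nat.mul_le_mul_left _ (Nat.pow_le_pow_left h i)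

/-! ### Composition of polynomial-time computable functions -/

namespace Turing

/-! ### Growth of stacks and length of the output -/

namespace TM2.Stmt

variable {K : Type*} {Γ : K → Type*} {Λ σ : Type*}

/-- The number of pushes in a statement. -/
def pushCount : TM2.Stmt Γ Λ σ → ℕ
  | push _ _ q => q.pushCount + 1
  | peek _ _ q => q.pushCount
  | pop _ _ q => q.pushCount
  | load _ q => q.pushCount
  | branch _ q₁ q₂ => q₁.pushCount + q₂.pushCount
  | goto _ => 0
  | halt => 0

theorem length_stepAux_le [DecidableEq K] (q : TM2.Stmt Γ Λ σ) (v : σ) (S : ∀ k, List (Γ k))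
    (k : K) : ((TM2.stepAux q v S).stk k).length ≤ (S k).length + q.pushCount := by
  induction q generalizing v S with
  | push k' f q ih =>
    refine (ih _ _).trans ?_
    by_cases h : k = k'
    · subst h; simp only [Function.update_self, List.length_cons, pushCount]; omega
    · simp only [Function.update_of_ne h, pushCount]; omega
  | peek k' f q ih => exact ih _ _
  | pop k' f q ih =>
    refine (ih _ _).trans ?_
    by_cases h : k = k'
    · subst h; simp [pushCount]
    · simp [pushCount, Function.update_of_ne h]
  | load f q ih => exact ih _ _
  | branch f q₁ q₂ ih₁ ih₂ =>
    have h₁ := ih₁ v S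
    have h₂ := ih₂ v S
    simp only [TM2.stepAux, pushCount]
    cases f v <;> simp <;> omega
  | goto f => simp [pushCount]
  | halt => simp [pushCount]

end TM2.Stmt

theorem initList_stk (tm : FinTM2) (s : List (tm.Γ tm.k₀)) :
    (initList tm s).stk = Function.update (fun _ => []) tm.k₀ s := by
  funext k
  by_cases h : k = tm.k₀
  · subst h; simp [initList]
  · simp [initList, h]

theorem haltList_stk (tm : FinTM2) (s : List (tm.Γ tm.k₁)) :
    (haltList tm s).stk = Function.update (fun _ => []) tm.k₁ s := by
  funext k
  by_cases h : k = tm.k₁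
  · subst h; simp [haltList]
  · simp [haltList, h]

/-- The length of the output is at most the length of the input plus a constant multiple of the
running time. -/
theorem FinTM2.exists_length_output_le (tm : FinTM2) : ∃ c : ℕ, ∀ t s s',
    ReachesIn tm.step t (initList tm s) (haltList tm s') → s'.length ≤ s.length + c * t := by
  have := tm.ΛFin
  -- One step executes the statement of a single label, so the sum over all labels bounds the pushes
  -- per step.
  refine ⟨∑ l : tm.Λ, (tm.m l).pushCount, fun t s s' h => ?_⟩
  have key := h.le_add_mul (μ := fun c => (c.stk tm.k₁).length)
    (c := ∑ l : tm.Λ, (tm.m l).pushCount) (by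
      rintro ⟨_ | l, v, S⟩ b hb
      · cases hb
      · obtain rfl : TM2.stepAux (tm.m l) v S = b := Option.some.inj hb
        refine (TM2.Stmt.length_stepAux_le _ _ _ _).trans ?_
        gcongr
        exact Finset.single_le_sum (f := fun l => (tm.m l).pushCount) (fun _ _ => Nat.zero_le _)
          (Finset.mem_univ l))
  simp only [haltList_stk, initList_stk, Function.update_self] at key
  refine key.trans ?_
  gcongr
  -- The output stack starts with the input if the two stacks coincide, and empty otherwise.
  by_cases h : tm.k₁ = tm.k₀
  · rw [h]; simp
  · simp [Function.update_of_ne h]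

/-! ### Running one machine after another -/

namespace FinTM2

variable (M N : FinTM2)

/-- The stack alphabets of two machines running side by side. -/
abbrev sumΓ : M.K ⊕ N.K → Type
  | .inl k => M.Γ k
  | .inr k => N.Γ k

/-- The stacks of two machines running side by side. -/
def sumStk {M N : FinTM2} (S : ∀ k, List (M.Γ k)) (T : ∀ k, List (N.Γ k)) :
    ∀ k, List (sumΓ M N k)
  | .inl k => S k
  | .inr k => T k

section

variable {M N}

theorem update_sumStk_inl (S : ∀ k, List (M.Γ k)) (T : ∀ k, List (N.Γ k)) (k : M.K)
    (l : List (M.Γ k)) :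
    Function.update (sumStk S T) (Sum.inl k) l = sumStk (Function.update S k l) T := by
  funext j
  rcases j with j | j
  · by_cases h : j = k
    · subst h; simp [sumStk]
    · rw [Function.update_of_ne (by simpa using h)]; simp [sumStk, h]
  · rw [Function.update_of_ne (by simp)]; rfl

theorem update_sumStk_inr (S : ∀ k, List (M.Γ k)) (T : ∀ k, List (N.Γ k)) (k : N.K)
    (l : List (N.Γ k)) :
    Function.update (sumStk S T) (Sum.inr k) l = sumStk S (Function.update T k l) := by
  funext j
  rcases j with j | j
  · rw [Function.update_of_ne (by simp)]; rfl
  · by_cases h : j = k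
    · subst h; simp [sumStk]
    · rw [Function.update_of_ne (by simpa using h)]; simp [sumStk, h]

end

/-- The internal states of the composed machine: those of the two machines, and a symbol that is
being carried from the first machine to the second. -/
abbrev CompState : Type := M.σ × N.σ × Option (N.Γ N.k₀)

/-- The labels of the composed machine: those of the first machine, `none` for the transfer between
the machines, and those of the second machine. -/
abbrev CompLabel : Type := Option (M.Λ ⊕ N.Λ)

open TM2.Stmt

/-- A statement of the first machine in the composed machine, which does not halt but goes on to the
transfer. -/
def compLeft : TM2.Stmt M.Γ M.Λ M.σ → TM2.Stmt (sumΓ M N) (CompLabel M N) (CompState M N)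
  | push k f q => push (Sum.inl k) (fun s => f s.1) (compLeft q)
  | peek k f q => peek (Sum.inl k) (fun s o => (f s.1 o, s.2)) (compLeft q)
  | pop k f q => pop (Sum.inl k) (fun s o => (f s.1 o, s.2)) (compLeft q)
  | load f q => load (fun s => (f s.1, s.2)) (compLeft q)
  | branch f q₁ q₂ => branch (fun s => f s.1) (compLeft q₁) (compLeft q₂)
  | goto f => goto (fun s => some (Sum.inl (f s.1)))
  | halt => goto (fun _ => none)

/-- A statement of the second machine in the composed machine. -/
def compRight : TM2.Stmt N.Γ N.Λ N.σ → TM2.Stmt (sumΓ M N) (CompLabel M N) (CompState M N)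
  | push k f q => push (Sum.inr k) (fun s => f s.2.1) (compRight q)
  | peek k f q => peek (Sum.inr k) (fun s o => (s.1, f s.2.1 o, s.2.2)) (compRight q)
  | pop k f q => pop (Sum.inr k) (fun s o => (s.1, f s.2.1 o, s.2.2)) (compRight q)
  | load f q => load (fun s => (s.1, f s.2.1, s.2.2)) (compRight q)
  | branch f q₁ q₂ => branch (fun s => f s.2.1) (compRight q₁) (compRight q₂)
  | goto f => goto (fun s => some (Sum.inr (f s.2.1)))
  | halt => halt

variable (e : M.Γ M.k₁ → N.Γ N.k₀)

/-- The transfer: the symbols on the output stack of the first machine are moved one by one to the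
input stack of the second machine, which reverses their order. -/
noncomputable def compTransfer [Nonempty (N.Γ N.k₀)] :
    TM2.Stmt (sumΓ M N) (CompLabel M N) (CompState M N) :=
  pop (Sum.inl M.k₁) (fun s o => (s.1, s.2.1, o.map e)) <|
    branch (fun s => s.2.2.isSome)
      -- The default is never used, as this branch is taken only when a symbol is being carried.
      (push (Sum.inr N.k₀) (fun s => s.2.2.getD (Classical.arbitrary _)) <| goto fun _ => none)
      (goto fun _ => some (Sum.inr N.main))

/-- The machine that runs `M`, and then `N` on the reversed output of `M`. -/
noncomputable def compReverse [Finite (N.Γ N.k₀)] [Nonempty (N.Γ N.k₀)]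
    [Fintype (M.Γ M.k₀)] : FinTM2 :=
  letI := M.kFin
  letI := N.kFin
  letI := M.ΛFin
  letI := N.ΛFin
  letI := M.σFin
  letI := N.σFin
  letI := Fintype.ofFinite (N.Γ N.k₀)
  { K := M.K ⊕ N.K
    k₀ := Sum.inl M.k₀
    k₁ := Sum.inr N.k₁
    Γ := sumΓ M N
    Λ := CompLabel M N
    main := some (Sum.inl M.main)
    σ := CompState M N
    initialState := (M.initialState, N.initialState, none)
    Γk₀Fin := (inferInstance : Fintype (M.Γ M.k₀))
    m := fun l => match l with
      | some (Sum.inl l) => compLeft M N (M.m l)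
      | none => compTransfer M N e
      | some (Sum.inr l) => compRight M N (N.m l) }

variable {M N}

/-- A configuration of the first machine in the composed machine. -/
def leftCfg (T : ∀ k, List (N.Γ k)) (w : N.σ × Option (N.Γ N.k₀)) (c : M.Cfg) :
    TM2.Cfg (sumΓ M N) (CompLabel M N) (CompState M N) :=
  ⟨some (c.l.map Sum.inl), (c.var, w), sumStk c.stk T⟩

/-- A configuration of the second machine in the composed machine. -/
def rightCfg (S : ∀ k, List (M.Γ k)) (v : M.σ) (o : Option (N.Γ N.k₀)) (c : N.Cfg) :
    TM2.Cfg (sumΓ M N) (CompLabel M N) (CompState M N) :=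
  ⟨c.l.map fun l => some (Sum.inr l), (v, c.var, o), sumStk S c.stk⟩

/-- Halting needs no separate treatment: `leftCfg` turns the absent label of a halted `M` into the
transfer label `none`, which is exactly where `compLeft` sends `halt`. -/
theorem stepAux_compLeft (q : TM2.Stmt M.Γ M.Λ M.σ) (v : M.σ) (w : N.σ × Option (N.Γ N.k₀))
    (S : ∀ k, List (M.Γ k)) (T : ∀ k, List (N.Γ k)) :
    TM2.stepAux (compLeft M N q) (v, w) (sumStk S T) = leftCfg T w (TM2.stepAux q v S) := by
  induction q generalizing v S with
  | push k f q ih => simp only [compLeft, TM2.stepAux, update_sumStk_inl]; exact ih _ _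
  | peek k f q ih => exact ih _ _
  | pop k f q ih => simp only [compLeft, TM2.stepAux, update_sumStk_inl]; exact ih _ _
  | load f q ih => exact ih _ _
  | branch f q₁ q₂ ih₁ ih₂ =>
    simp only [compLeft, TM2.stepAux]
    cases f v
    · exact ih₂ _ _
    · exact ih₁ _ _
  | goto f => rfl
  | halt => rfl

theorem stepAux_compRight (q : TM2.Stmt N.Γ N.Λ N.σ) (v : M.σ) (w : N.σ)
    (o : Option (N.Γ N.k₀)) (S : ∀ k, List (M.Γ k)) (T : ∀ k, List (N.Γ k)) :
    TM2.stepAux (compRight M N q) (v, w, o) (sumStk S T) =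
      rightCfg S v o (TM2.stepAux q w T) := by
  induction q generalizing w T with
  | push k f q ih => simp only [compRight, TM2.stepAux, update_sumStk_inr]; exact ih _ _
  | peek k f q ih => exact ih _ _
  | pop k f q ih => simp only [compRight, TM2.stepAux, update_sumStk_inr]; exact ih _ _
  | load f q ih => exact ih _ _
  | branch f q₁ q₂ ih₁ ih₂ =>
    simp only [compRight, TM2.stepAux]
    cases f w
    · exact ih₂ _ _
    · exact ih₁ _ _
  | goto f => rfl
  | halt => rfl

variable [Finite (N.Γ N.k₀)] [Nonempty (N.Γ N.k₀)] [Fintype (M.Γ M.k₀)]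

theorem step_leftCfg (T : ∀ k, List (N.Γ k)) (w : N.σ × Option (N.Γ N.k₀)) (c c' : M.Cfg)
    (h : M.step c = some c') :
    (compReverse M N e).step (leftCfg T w c) = some (leftCfg T w c') := by
  obtain ⟨_ | l, v, S⟩ := c
  · cases h
  · obtain rfl : TM2.stepAux (M.m l) v S = c' := Option.some.inj h
    exact congrArg some (stepAux_compLeft (M.m l) v w S T)

theorem step_rightCfg (S : ∀ k, List (M.Γ k)) (v : M.σ) (o : Option (N.Γ N.k₀)) (c c' : N.Cfg)
    (h : N.step c = some c') :
    (compReverse M N e).step (rightCfg S v o c) = some (rightCfg S v o c') := by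
  obtain ⟨_ | l, w, T⟩ := c
  · cases h
  · obtain rfl : TM2.stepAux (N.m l) w T = c' := Option.some.inj h
    exact congrArg some (stepAux_compRight (N.m l) v w o S T)

theorem reachesIn_transfer (v : M.σ) (w : N.σ) (o : Option (N.Γ N.k₀))
    (s : List (M.Γ M.k₁)) (t : List (N.Γ N.k₀)) :
    ReachesIn (compReverse M N e).step (s.length + 1)
      ⟨some none, (v, w, o),
        sumStk (Function.update (fun _ => []) M.k₁ s) (Function.update (fun _ => []) N.k₀ t)⟩
      ⟨some (some (Sum.inr N.main)), (v, w, none),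
        sumStk (fun _ => []) (Function.update (fun _ => []) N.k₀ ((s.map e).reverse ++ t))⟩ := by
  induction s generalizing o t with
  | nil =>
    refine .single (congrArg some ?_)
    change TM2.stepAux (compTransfer M N e) _ _ = _
    simp [compTransfer, update_sumStk_inl, sumStk]
    rfl
  | cons a s ih =>
    refine .head (b := ⟨some none, (v, w, some (e a)), sumStk (Function.update (fun _ => []) M.k₁ s)
      (Function.update (fun _ => []) N.k₀ (e a :: t))⟩) (congrArg some ?_) ?_
    · change TM2.stepAux (compTransfer M N e) _ _ = _
      simp [compTransfer, update_sumStk_inl, update_sumStk_inr, sumStk]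
      rfl
    · simpa using ih (some (e a)) (e a :: t)

theorem initList_compReverse (s : List (M.Γ M.k₀)) :
    initList (compReverse M N e) s =
      leftCfg (fun _ => []) (N.initialState, none) (initList M s) := by
  have h : (initList (compReverse M N e) s).stk = sumStk (initList M s).stk (fun _ => []) := by
    rw [initList_stk, ← update_sumStk_inl]
    have h₀ : (fun _ => []) = sumStk (fun _ : M.K => ([] : List (M.Γ _)))
        (fun _ : N.K => ([] : List (N.Γ _))) := by
      funext k
      cases k <;> rfl
    rw [← h₀]
    exact initList_stk (compReverse M N e) s
  exact congrArg (fun S => (⟨_, _, S⟩ : TM2.Cfg (sumΓ M N) (CompLabel M N) (CompState M N))) h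

theorem haltList_compReverse (r : List (N.Γ N.k₁)) :
    haltList (compReverse M N e) r =
      rightCfg (fun _ => []) M.initialState none (haltList N r) := by
  have h : (haltList (compReverse M N e) r).stk = sumStk (fun _ => []) (haltList N r).stk := by
    rw [haltList_stk, ← update_sumStk_inr]
    have h₀ : (fun _ => []) = sumStk (fun _ : M.K => ([] : List (M.Γ _)))
        (fun _ : N.K => ([] : List (N.Γ _))) := by
      funext k
      cases k <;> rfl
    rw [← h₀]
    exact haltList_stk (compReverse M N e) r
  exact congrArg (fun S => (⟨_, _, S⟩ : TM2.Cfg (sumΓ M N) (CompLabel M N) (CompState M N))) h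

/-- The three runs fit together because `haltList` demands the initial state and empty stacks apart
from the output. Once the transfer has emptied that stack, `M` leaves no trace and `N` starts from a
genuine initial configuration. -/
theorem reachesIn_compReverse {t₁ t₂ : ℕ} {s : List (M.Γ M.k₀)} {s' : List (M.Γ M.k₁)}
    {r : List (N.Γ N.k₁)} (h₁ : ReachesIn M.step t₁ (initList M s) (haltList M s'))
    (h₂ : ReachesIn N.step t₂ (initList N (s'.map e).reverse) (haltList N r)) :
    ReachesIn (compReverse M N e).step (t₁ + (s'.length + 1) + t₂)
      (initList (compReverse M N e) s) (haltList (compReverse M N e) r) := by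
  have a₁ := h₁.map (step_leftCfg e (fun _ => []) (N.initialState, none))
  have a₂ := reachesIn_transfer e M.initialState N.initialState none s' []
  have a₃ := h₂.map (step_rightCfg e (fun _ => []) M.initialState none)
  rw [List.append_nil, Function.update_eq_self, ← haltList_stk, ← initList_stk] at a₂
  rw [initList_compReverse, haltList_compReverse]
  exact (a₁.trans a₂).trans a₃

end FinTM2

/-- If `f` is computable in polynomial time, and so is `g` from the reversed descriptions of its
arguments, then `g ∘ f` is computable in polynomial time. -/
theorem TM2ComputableInPolyTime.comp_of_reverse {α β γ αΓ βΓ γΓ : Type} [Finite βΓ] [Nonempty βΓ]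
    {eα : α → List αΓ} {eβ : β → List βΓ} {eγ : γ → List γΓ} {f : α → β} {g : β → γ}
    (hf : TM2ComputableInPolyTime eα eβ f)
    (hg : TM2ComputableInPolyTime (fun b => (eβ b).reverse) eγ g) :
    Nonempty (TM2ComputableInPolyTime eα eγ (g ∘ f)) := by
  have : Finite (hg.tm.Γ hg.tm.k₀) := Finite.of_equiv _ hg.inputAlphabet.symm
  have : Nonempty (hg.tm.Γ hg.tm.k₀) := hg.inputAlphabet.nonempty
  have := hf.tm.Γk₀Fin
  obtain ⟨c, hc⟩ := hf.tm.exists_length_output_le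
  -- The summands of the time bound are for the first machine, the transfer (one step per symbol and
  -- one more), and the second machine on a word of length at most |input| + c · time.
  refine ⟨⟨⟨FinTM2.compReverse hf.tm hg.tm (hg.inputAlphabet.symm ∘ hf.outputAlphabet),
    hf.inputAlphabet, hg.outputAlphabet⟩, hf.time + (Polynomial.X + Polynomial.C c * hf.time + 1)
      + hg.time.comp (Polynomial.X + Polynomial.C c * hf.time), fun a => ?_⟩⟩
  obtain ⟨⟨t₁, e₁⟩, l₁⟩ := hf.outputsFun a
  obtain ⟨⟨t₂, e₂⟩, l₂⟩ := hg.outputsFun (f a)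
  have r₁ := ReachesIn.iff_iterate.2 e₁
  have r₂ := ReachesIn.iff_iterate.2 e₂
  have hlen := hc _ _ _ r₁
  simp only [List.length_map, List.length_reverse] at hlen l₁ l₂
  have hlen' : (eβ (f a)).length ≤ (eα a).length + c * hf.time.eval (eα a).length :=
    hlen.trans (by gcongr)
  have r := FinTM2.reachesIn_compReverse (hg.inputAlphabet.symm ∘ hf.outputAlphabet) r₁
    (r := (eγ (g (f a))).map hg.outputAlphabet.invFun) (t₂ := t₂) (by
      convert! r₂ using 2
      rw [List.map_map, ← List.map_reverse]
      congr 1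
      funext x
      simp)
  refine ⟨⟨_, ReachesIn.iff_iterate.1 r⟩, ?_⟩
  have hmono := hg.time.eval_le_eval_of_le hlen'
  simp only [List.length_map, Polynomial.eval_add, Polynomial.eval_X, Polynomial.eval_mul,
    Polynomial.eval_C, Polynomial.eval_one, Polynomial.eval_comp]
  omega

end Turing

/-! ### The triangle graph -/

namespace SimpleGraph

variable {V W : Type}

theorem minEdgeDeletionBipartition_le_of_iso [Finite W] {G : SimpleGraph V} {H : SimpleGraph W}
    (e : G ≃g H) : G.minEdgeDeletionBipartition ≤ H.minEdgeDeletionBipartition := by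
  classical
  obtain ⟨s, hs, ⟨χ⟩, hcard⟩ := H.minEdgeDeletionBipartition_attained
  have hinj : Function.Injective (Sym2.map e.symm) := Sym2.map.injective e.symm.injective
  refine Nat.sInf_le ⟨s.image (Sym2.map e.symm), ?_, ⟨?_⟩,
    by rw [Finset.card_image_of_injective _ hinj, hcard]⟩
  · intro x hx
    simp only [Finset.coe_image, Set.mem_image] at hx
    obtain ⟨y, hy, rfl⟩ := hx
    have := hs hy
    induction y with
    | _ a b => exact e.symm.map_adj_iff.2 this
  · refine Coloring.mk (fun v => χ (e v)) ?_
    intro v w hvw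
    refine χ.valid ?_
    rw [deleteEdges_adj] at hvw ⊢
    refine ⟨e.map_adj_iff.2 hvw.1, fun h => hvw.2 ?_⟩
    simp only [Finset.coe_image, Set.mem_image]
    exact ⟨_, h, by simp⟩

theorem minEdgeDeletionBipartition_congr [Finite V] [Finite W] {G : SimpleGraph V}
    {H : SimpleGraph W} (e : G ≃g H) :
    G.minEdgeDeletionBipartition = H.minEdgeDeletionBipartition :=
  (minEdgeDeletionBipartition_le_of_iso e).antisymm (minEdgeDeletionBipartition_le_of_iso e.symm)

/-- `ρ v u` is the number of the neighbour `u` of `v`, the neighbours of every vertex being numbered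
`1, 2, 3`. -/
structure IsNeighborNumbering (G : SimpleGraph V) (ρ : V → V → Fin 4) : Prop where
  ne_zero : ∀ v u, G.Adj v u → ρ v u ≠ 0
  injOn : ∀ v u u', G.Adj v u → G.Adj v u' → ρ v u = ρ v u' → u = u'
  exists_adj : ∀ v i, i ≠ 0 → ∃ u, G.Adj v u ∧ ρ v u = i

/-- The triangle graph: a vertex `(v, 0)` for each vertex `v` of `G` and a triangle
`(v, 1)`, `(v, 2)`, `(v, 3)` whose corners are joined to `(u, 0)` for the three neighbours
`u` of `v`. -/
def triangleGraph (G : SimpleGraph V) (ρ : V → V → Fin 4) : SimpleGraph (V × Fin 4) where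
  Adj x y := (x.1 = y.1 ∧ x.2 ≠ y.2 ∧ x.2 ≠ 0 ∧ y.2 ≠ 0) ∨
    (G.Adj x.1 y.1 ∧ ((x.2 = 0 ∧ y.2 = ρ y.1 x.1) ∨ (y.2 = 0 ∧ x.2 = ρ x.1 y.1)))
  symm := ⟨by
    rintro x y (⟨h₁, h₂, h₃, h₄⟩ | ⟨h₁, h₂⟩)
    · exact .inl ⟨h₁.symm, h₂.symm, h₄, h₃⟩
    · exact .inr ⟨h₁.symm, h₂.symm⟩⟩
  loopless := ⟨by
    rintro x (⟨-, h, -⟩ | ⟨h, -⟩)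
    · exact h rfl
    · exact G.loopless.irrefl _ h⟩

/-! ### Degrees of the triangle graph; cheap deletion sets and NAE decompositions -/

section

variable {G : SimpleGraph V} {ρ : V → V → Fin 4}

theorem triangleGraph_adj_triangle (v : V) {i j : Fin 4} (hij : i ≠ j) (hi : i ≠ 0) (hj : j ≠ 0) :
    (G.triangleGraph ρ).Adj (v, i) (v, j) :=
  .inl ⟨rfl, hij, hi, hj⟩

theorem triangleGraph_adj_center {v u : V} (h : G.Adj v u) :
    (G.triangleGraph ρ).Adj (v, ρ v u) (u, 0) :=
  .inr ⟨h, .inr ⟨rfl, rfl⟩⟩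

/-- A centre meets one corner in the triangle of each of its three neighbours. A corner meets the
other two corners and the centre of the one neighbour whose number it bears. -/
theorem IsNeighborNumbering.ncard_neighborSet_triangleGraph (hρ : G.IsNeighborNumbering ρ)
    (x : V × Fin 4) : ((G.triangleGraph ρ).neighborSet x).ncard = 3 := by
  obtain ⟨v, i⟩ := x
  choose u hu hui using hρ.exists_adj v
  by_cases hi : i = 0
  · subst hi
    have h1 : (1 : Fin 4) ≠ 0 := by decide
    have h2 : (2 : Fin 4) ≠ 0 := by decide
    have h3 : (3 : Fin 4) ≠ 0 := by decide
    have hne : ∀ i j hi hj, i ≠ j → u i hi ≠ u j hj := by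
      intro i j hi hj hij h
      exact hij (by rw [← hui i hi, ← hui j hj, h])
    have : (G.triangleGraph ρ).neighborSet (v, 0) =
        {(u 1 h1, ρ (u 1 h1) v), (u 2 h2, ρ (u 2 h2) v), (u 3 h3, ρ (u 3 h3) v)} := by
      ext ⟨w, j⟩
      simp only [mem_neighborSet, triangleGraph, Set.mem_insert_iff, Set.mem_singleton_iff,
        Prod.mk.injEq]
      constructor
      · rintro (⟨-, -, h, -⟩ | ⟨h, ⟨-, rfl⟩ | ⟨rfl, h'⟩⟩)
        · exact absurd rfl h
        · have hw := hρ.ne_zero _ _ h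
          have key : ∀ i hi, ρ v w = i → w = u i hi := fun i hi hw' =>
            hρ.injOn v _ _ h (hu i hi) (hw'.trans (hui i hi).symm)
          have hcases : ∀ i : Fin 4, i ≠ 0 → i = 1 ∨ i = 2 ∨ i = 3 := by decide
          rcases hcases _ hw with h | h | h
          · obtain rfl := key 1 h1 h; simp
          · obtain rfl := key 2 h2 h; simp
          · obtain rfl := key 3 h3 h; simp
        · exact absurd h'.symm (hρ.ne_zero _ _ h)
      · rintro (⟨rfl, rfl⟩ | ⟨rfl, rfl⟩ | ⟨rfl, rfl⟩)
        · exact .inr ⟨hu _ h1, .inl ⟨trivial, rfl⟩⟩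
        · exact .inr ⟨hu _ h2, .inl ⟨trivial, rfl⟩⟩
        · exact .inr ⟨hu _ h3, .inl ⟨trivial, rfl⟩⟩
    rw [this, Set.ncard_eq_three]
    exact ⟨_, _, _, by simp [hne 1 2 h1 h2 (by decide)], by simp [hne 1 3 h1 h3 (by decide)],
      by simp [hne 2 3 h2 h3 (by decide)], rfl⟩
  · have hjk : ∀ i : Fin 4, i ≠ 0 → ∃ j k : Fin 4, j ≠ k ∧ j ≠ 0 ∧ k ≠ 0 ∧ j ≠ i ∧ k ≠ i ∧
        ∀ l, l ≠ i → l ≠ 0 → l = j ∨ l = k := by decide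
    obtain ⟨j, k, h₁, hj, hk, h₂, h₃, hl⟩ := hjk i hi
    have : (G.triangleGraph ρ).neighborSet (v, i) = {(v, j), (v, k), (u i hi, 0)} := by
      ext ⟨w, l⟩
      simp only [mem_neighborSet, triangleGraph, Set.mem_insert_iff, Set.mem_singleton_iff,
        Prod.mk.injEq]
      constructor
      · rintro (⟨rfl, h, -, h'⟩ | ⟨h, ⟨h', -⟩ | ⟨rfl, h'⟩⟩)
        · rcases hl l (Ne.symm h) h' with rfl | rfl <;> simp
        · exact absurd h' hi
        · exact .inr (.inr ⟨hρ.injOn v _ _ h (hu i hi) (h'.symm.trans (hui i hi).symm), rfl⟩)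
      · rintro (⟨rfl, rfl⟩ | ⟨rfl, rfl⟩ | ⟨rfl, rfl⟩)
        · exact .inl ⟨rfl, h₂.symm, hi, hj⟩
        · exact .inl ⟨rfl, h₃.symm, hi, hk⟩
        · exact .inr ⟨hu i hi, .inr ⟨rfl, (hui i hi).symm⟩⟩
    rw [this, Set.ncard_eq_three]
    exact ⟨_, _, _, by simp [h₁], by simp [hj], by simp [hk], rfl⟩

theorem fst_eq_of_triangle_edge_eq {v v' : V} {i j i' j' : Fin 4}
    (h : s((v, i), (v, j)) = s((v', i'), (v', j'))) : v = v' := by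
  rcases Sym2.eq_iff.1 h with ⟨h, -⟩ | ⟨h, -⟩ <;> exact congrArg Prod.fst h

/-- Tight counting: every triangle loses an edge, so a deletion set of at most |V| edges has no room
for a second edge of a triangle or for an edge at a centre. -/
theorem IsNeighborNumbering.hasNAEDecomposition_of_le [Finite V] (hρ : G.IsNeighborNumbering ρ)
    (h : (G.triangleGraph ρ).minEdgeDeletionBipartition ≤ Nat.card V) :
    G.HasNAEDecomposition := by
  classical
  have := Fintype.ofFinite V
  obtain ⟨s, -, ⟨χ⟩, hcard⟩ := (G.triangleGraph ρ).minEdgeDeletionBipartition_attained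
  rw [← hcard, Nat.card_eq_fintype_card] at h
  have hmem : ∀ x y, (G.triangleGraph ρ).Adj x y → χ x = χ y → s(x, y) ∈ s := by
    intro x y hxy hχ
    by_contra hs
    exact χ.valid (v := x) (w := y) (by rw [deleteEdges_adj]; exact ⟨hxy, hs⟩) hχ
  have htri : ∀ v, ∃ i j : Fin 4, i ≠ j ∧ i ≠ 0 ∧ j ≠ 0 ∧ s((v, i), (v, j)) ∈ s := by
    intro v
    have hpig : ∀ f : Fin 4 → Fin 2, ∃ i j : Fin 4, i ≠ j ∧ i ≠ 0 ∧ j ≠ 0 ∧ f i = f j := by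
      decide
    obtain ⟨i, j, hij, hi, hj, hf⟩ := hpig fun i => χ (v, i)
    exact ⟨i, j, hij, hi, hj, hmem _ _ (triangleGraph_adj_triangle v hij hi hj) hf⟩
  choose i j hij hi hj hs using htri
  have hinj : Function.Injective fun v => s((v, i v), (v, j v)) := fun v v' h =>
    fst_eq_of_triangle_edge_eq h
  have hsurj : ∀ x ∈ s, ∃ v, s((v, i v), (v, j v)) = x := by
    have : Finset.univ.image (fun v => s((v, i v), (v, j v))) = s := by
      refine Finset.eq_of_subset_of_card_le ?_ ?_
      · intro x hx
        obtain ⟨v, -, rfl⟩ := Finset.mem_image.1 hx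
        exact hs v
      · rwa [Finset.card_image_of_injective _ hinj, Finset.card_univ]
    intro x hx
    rw [← this] at hx
    simpa using hx
  have hcenter : ∀ v u, G.Adj v u → χ (v, ρ v u) ≠ χ (u, 0) := by
    intro v u hvu hχ
    obtain ⟨w, hw⟩ := hsurj _ (hmem _ _ (triangleGraph_adj_center hvu) hχ)
    rcases Sym2.eq_iff.1 hw with ⟨-, h⟩ | ⟨h, -⟩
    · exact hj w (congrArg Prod.snd h)
    · exact hi w (congrArg Prod.snd h)
  have hcolor : ∀ v c, ∃ k, k ≠ 0 ∧ χ (v, k) = c := by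
    intro v c
    by_contra! hc
    have hc' : ∀ k, k ≠ 0 → χ (v, k) = 1 - c := by
      have : ∀ a b : Fin 2, a ≠ b → a = 1 - b := by decide
      exact fun k hk => this _ _ (hc k hk)
    -- In a monochromatic triangle all edges would be deleted, but only the chosen edge of `v` is
    -- available.
    have huniq : ∀ k l : Fin 4, k ≠ l → k ≠ 0 → l ≠ 0 →
        s((v, k), (v, l)) = s((v, i v), (v, j v)) := by
      intro k l hkl hk hl
      obtain ⟨w, hw⟩ := hsurj _ (hmem _ _ (triangleGraph_adj_triangle v hkl hk hl)
        ((hc' k hk).trans (hc' l hl).symm))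
      obtain rfl := fst_eq_of_triangle_edge_eq hw
      exact hw.symm
    have h := (huniq 1 2 (by decide) (by decide) (by decide)).trans
      (huniq 1 3 (by decide) (by decide) (by decide)).symm
    simp at h
  have hnbr : ∀ v c, ∃ u, G.Adj v u ∧ χ (u, 0) ≠ c := by
    intro v c
    obtain ⟨k, hk, hkc⟩ := hcolor v c
    obtain ⟨u, hu, rfl⟩ := hρ.exists_adj v k hk
    exact ⟨u, hu, fun h => hcenter v u hu (hkc.trans h.symm)⟩
  have hfin : ∀ a : Fin 2, a ≠ 1 → a = 0 := by decide
  refine ⟨{u | χ (u, 0) = 0}, fun v => ?_, fun v => ?_⟩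
  · obtain ⟨u, hu, h⟩ := hnbr v 1
    exact ⟨u, hfin _ h, hu⟩
  · obtain ⟨u, hu, h⟩ := hnbr v 0
    exact ⟨u, h, hu⟩

/-- Colour the centres by membership in `A` and each corner opposite to its centre. Edges at centres
are then bichromatic, and each triangle, having both colours, contains just one monochromatic edge,
which is deleted. -/
theorem IsNeighborNumbering.le_of_hasNAEDecomposition [Finite V] (hρ : G.IsNeighborNumbering ρ)
    (h : G.HasNAEDecomposition) :
    (G.triangleGraph ρ).minEdgeDeletionBipartition ≤ Nat.card V := by
  classical
  have := Fintype.ofFinite V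
  obtain ⟨A, hA, hA'⟩ := h
  choose u hu hui using hρ.exists_adj
  let χ : V × Fin 4 → Bool := fun x =>
    if hx : x.2 = 0 then decide (x.1 ∈ A) else !decide (u x.1 x.2 hx ∈ A)
  have hχ0 : ∀ v, χ (v, 0) = decide (v ∈ A) := fun v => by simp [χ]
  have hχ : ∀ v w, G.Adj v w → χ (v, ρ v w) = !decide (w ∈ A) := by
    intro v w h
    have h0 := hρ.ne_zero v w h
    simp only [χ, h0, dite_false]
    rw [hρ.injOn v _ _ (hu v _ h0) h (hui v _ h0)]
  have hpair : ∀ v, ∃ i j : Fin 4, i ≠ j ∧ i ≠ 0 ∧ j ≠ 0 ∧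
      ∀ k l, k ≠ l → k ≠ 0 → l ≠ 0 → χ (v, k) = χ (v, l) → (k = i ∧ l = j) ∨ (k = j ∧ l = i) := by
    intro v
    have hf : ∀ f : Fin 4 → Bool, (∃ k, k ≠ 0 ∧ f k = true) → (∃ k, k ≠ 0 ∧ f k = false) →
        ∃ i j : Fin 4, i ≠ j ∧ i ≠ 0 ∧ j ≠ 0 ∧
          ∀ k l, k ≠ l → k ≠ 0 → l ≠ 0 → f k = f l → (k = i ∧ l = j) ∨ (k = j ∧ l = i) := by
      decide
    refine hf (fun k => χ (v, k)) ?_ ?_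
    -- Corners are coloured oppositely, so a neighbour outside `A` supplies the corner coloured
    -- `true`.
    · obtain ⟨w, hw, hvw⟩ := hA' v
      exact ⟨_, hρ.ne_zero _ _ hvw, by simpa [hχ v w hvw] using hw⟩
    · obtain ⟨w, hw, hvw⟩ := hA v
      exact ⟨_, hρ.ne_zero _ _ hvw, by simpa [hχ v w hvw] using hw⟩
  choose i j hij hi hj hpair using hpair
  let s : Finset (Sym2 (V × Fin 4)) := Finset.univ.image fun v => s((v, i v), (v, j v))
  have hs : s.card ≤ Nat.card V := by
    rw [Nat.card_eq_fintype_card]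
    exact Finset.card_image_le
  refine le_trans (Nat.sInf_le ⟨s, ?_, ?_, rfl⟩) hs
  · intro x hx
    obtain ⟨v, -, rfl⟩ := Finset.mem_image.1 (Finset.mem_coe.1 hx)
    exact triangleGraph_adj_triangle v (hij v) (hi v) (hj v)
  · refine (Coloring.colorable (Coloring.mk χ ?_) : (Colorable _ (Fintype.card Bool)))
    rintro ⟨v, k⟩ ⟨w, l⟩ hvw hχe
    rw [deleteEdges_adj] at hvw
    obtain ⟨hadj, hvw⟩ := hvw
    simp only [triangleGraph] at hadj
    rcases hadj with ⟨rfl, h₁, h₂, h₃⟩ | ⟨h₁, ⟨rfl, rfl⟩ | ⟨rfl, rfl⟩⟩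
    · refine hvw (Finset.mem_coe.2 (Finset.mem_image.2 ⟨v, Finset.mem_univ _, ?_⟩))
      rcases hpair v k l h₁ h₂ h₃ hχe with ⟨rfl, rfl⟩ | ⟨rfl, rfl⟩
      · rfl
      · exact Sym2.eq_swap
    · have := hχ w v h₁.symm
      rw [hχ0] at hχe
      simp [← hχe] at this
    · have := hχ v w h₁
      rw [hχ0] at hχe
      simp [hχe] at this

end

end SimpleGraph

/-! ### A machine that writes down the triangle graph -/

namespace TriangleMachine

/-- What the machine remembers about a column `w` of the adjacency matrix while the row `v` is being
processed: whether the entry is set, whether it lies on the diagonal, whether the diagonal has been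
passed in this column, the number of set entries `(v, u)` with `u ≥ w`, and the number of set entries
`(u, w)` with `u ≥ v`. -/
structure Column where
  /-- the entry in the current row -/
  adj : Bool
  /-- the entry lies on the diagonal -/
  diag : Bool
  /-- the diagonal entry of this column has been read -/
  passed : Bool
  /-- the number of set entries in the row, up to this one -/
  row : Fin 4
  /-- the number of set entries in the column, up to this one -/
  col : Fin 4
  deriving DecidableEq, Fintype

/-- A column of which nothing has been read. -/
def Column.fresh : Column := ⟨false, false, false, 0, 0⟩

/-- The entry `(i, j)` of the block of the new matrix that replaces the entry of the old one. -/
def Column.bit (c : Column) (i j : Fin 4) : Bool :=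
  (c.diag && (decide (i ≠ j) && (decide (i ≠ 0) && decide (j ≠ 0)))) ||
    -- In row v and column w, `c.row` is the number of w at v; by symmetry of the matrix `c.col` is
    -- the number of v at w.
    (c.adj && ((decide (i = 0) && decide (j = c.col)) || (decide (j = 0) && decide (i = c.row))))

theorem Column.bit_eq_true (c : Column) (i j : Fin 4) : c.bit i j = true ↔
    (c.diag = true ∧ i ≠ j ∧ i ≠ 0 ∧ j ≠ 0) ∨
      (c.adj = true ∧ ((i = 0 ∧ j = c.col) ∨ (j = 0 ∧ i = c.row))) := by
  simp [Column.bit]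

/-- A bit as a number. -/
def bitNum (b : Bool) : Fin 4 := bif b then 1 else 0

/-- The state of a column after reading the entry `b`, where `r` counts the set entries of the row so
far and `seen` says whether the diagonal has been passed in the row. -/
def Column.update (r : Fin 4) (seen b : Bool) (c : Column) : Column :=
  -- With rows and columns arriving in decreasing order, the diagonal entry is the first one of the
  -- row whose column has not met the diagonal in an earlier row. No index has to be stored.
  ⟨b, !c.passed && !seen, c.passed || (!c.passed && !seen), r + bitNum b, c.col + bitNum b⟩

/-- The states of the columns after reading the entries `bs` of a row. -/
def scan (r : Fin 4) (seen : Bool) : List Bool → List Column → List Column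
  | [], _ => []
  | b :: bs, l =>
    let c := (l.head?.getD Column.fresh).update r seen b
    c :: scan c.row (seen || c.diag) bs l.tail

theorem length_scan (r : Fin 4) (seen : Bool) (bs : List Bool) (l : List Column) :
    (scan r seen bs l).length = bs.length := by
  induction bs generalizing r seen l with
  | nil => rfl
  | cons b bs ih => simp [scan, ih]

/-- The stacks. -/
inductive Stack
  | input
  | output
  | cols
  | aux
  deriving DecidableEq

instance : Fintype Stack := ⟨{.input, .output, .cols, .aux}, fun k => by cases k <;> decide⟩

/-- The stack alphabets. -/
abbrev Γ : Stack → Type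
  | .input => Option Bool
  | .output => Option Bool ⊕ Unit
  | .cols => Column
  | .aux => Column

/-- The labels. -/
inductive Label
  | next
  | read
  | rewind (k : Fin 5)
  | emit (k : Fin 4)
  | clear
  deriving DecidableEq, Fintype

/-- The internal states. -/
structure State where
  /-- the last input symbol -/
  inp : Option (Option Bool)
  /-- the last column -/
  col : Option Column
  /-- the number of set entries in the row so far -/
  row : Fin 4
  /-- the diagonal has been passed in the row -/
  seen : Bool
  deriving DecidableEq, Fintype

/-- The initial state. -/
def State.init : State := ⟨none, none, 0, false⟩

/-- Processing an entry. -/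
def State.update (s : State) : State :=
  let c := (s.col.getD Column.fresh).update s.row s.seen (s.inp.join.getD false)
  ⟨s.inp, some c, c.row, s.seen || c.diag⟩

/-- The last column read, as a symbol. -/
def State.column (s : State) : Column := s.col.getD Column.fresh

/-- The instruction that records the column popped from a stack. -/
def State.setCol (s : State) (o : Option Column) : State := { s with col := o }

open TM2.Stmt

/-- What happens when the columns have been rewound. -/
def afterRewind : Fin 5 → TM2.Stmt Γ Label State :=
  Fin.cases (goto fun _ => .next)
    (fun k => push .output (fun _ => Sum.inl none) <| goto fun _ => .emit k)

/-- The label after the columns have been rewound. -/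
def afterRewindLabel : Fin 5 → Label :=
  Fin.cases .next .emit

/-- The output after the columns have been rewound. -/
def afterRewindOutput (k : Fin 5) (o : List (Option Bool ⊕ Unit)) : List (Option Bool ⊕ Unit) :=
  Fin.cases o (fun _ => Sum.inl none :: o) k

/-- The program. -/
def program : Label → TM2.Stmt Γ Label State
  | .next =>
    pop .input (fun _ o => ⟨o, none, 0, false⟩) <|
      branch (fun s => s.inp.isSome) (goto fun _ => .read) (goto fun _ => .clear)
  | .read =>
    -- A row mark must stay on the stack, as it opens the next row. After `join`, it looks the same
    -- as the end of the input.
    peek .input (fun s o => { s with inp := o }) <|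
      branch (fun s => s.inp.join.isSome)
        (pop .input (fun s _ => s) <|
          pop .cols State.setCol <|
            branch (fun s => s.col.isNone)
              -- The column stack is empty only while the first row is read. Its n unary marks
              -- therefore lie below all matrix text, which puts them at the end of the output.
              (push .output (fun _ => Sum.inr ()) <| load State.update <|
                push .aux State.column <| goto fun _ => .read)
              (load State.update <| push .aux State.column <| goto fun _ => .read))
        (goto fun _ => .rewind 4)
  | .rewind k =>
    pop .aux State.setCol <|
      branch (fun s => s.col.isSome)
        (push .cols State.column <| goto fun _ => .rewind k)
        (afterRewind k)
  | .emit k =>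
    pop .cols State.setCol <|
      branch (fun s => s.col.isSome)
        (push .aux State.column <|
          push .output (fun s => Sum.inl (some (s.column.bit k 3))) <|
          push .output (fun s => Sum.inl (some (s.column.bit k 2))) <|
          push .output (fun s => Sum.inl (some (s.column.bit k 1))) <|
          push .output (fun s => Sum.inl (some (s.column.bit k 0))) <|
          goto fun _ => .emit k)
        (goto fun _ => .rewind k.castSucc)
  | .clear =>
    -- A final configuration must have empty work stacks and the initial state.
    pop .cols State.setCol <|
      branch (fun s => s.col.isSome) (goto fun _ => .clear) (load (fun _ => State.init) halt)

/-- The machine. -/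
def machine : FinTM2 where
  K := Stack
  k₀ := .input
  k₁ := .output
  Γ := Γ
  Λ := Label
  main := .next
  σ := State
  initialState := State.init
  Γk₀Fin := (inferInstance : Fintype (Option Bool))
  m := program

/-- The contents of the four stacks. -/
def contents (i : List (Option Bool)) (o : List (Option Bool ⊕ Unit)) (c a : List Column) :
    ∀ k, List (Γ k)
  | .input => i
  | .output => o
  | .cols => c
  | .aux => a

section

variable (i i' : List (Option Bool)) (o o' : List (Option Bool ⊕ Unit)) (c c' a a' : List Column)

@[simp]
theorem update_contents_input :
    Function.update (contents i o c a) .input i' = contents i' o c a := by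
  funext k; cases k <;> rfl

@[simp]
theorem update_contents_output :
    Function.update (contents i o c a) .output o' = contents i o' c a := by
  funext k; cases k <;> rfl

@[simp]
theorem update_contents_cols :
    Function.update (contents i o c a) .cols c' = contents i o c' a := by
  funext k; cases k <;> rfl

@[simp]
theorem update_contents_aux :
    Function.update (contents i o c a) .aux a' = contents i o c a' := by
  funext k; cases k <;> rfl

@[simp] theorem contents_input : contents i o c a .input = i := rfl
@[simp] theorem contents_output : contents i o c a .output = o := rfl
@[simp] theorem contents_cols : contents i o c a .cols = c := rfl
@[simp] theorem contents_aux : contents i o c a .aux = a := rfl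

end

/-! ### Step counts for the phases of the program -/

/-- Runs of the program. -/
abbrev Runs (t : ℕ) (a b : TM2.Cfg Γ Label State) : Prop :=
  ReachesIn (TM2.step program) t a b

theorem runs_rewind (k : Fin 5) (s : State) (i : List (Option Bool))
    (o : List (Option Bool ⊕ Unit)) (c a : List Column) :
    Runs (a.length + 1) ⟨some (.rewind k), s, contents i o c a⟩
      ⟨some (afterRewindLabel k), s.setCol none,
        contents i (afterRewindOutput k o) (a.reverse ++ c) []⟩ := by
  induction a generalizing s c with
  | nil =>
    refine .single ?_
    cases k using Fin.cases <;>
      simp [program, afterRewind, afterRewindLabel, afterRewindOutput, State.setCol]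
  | cons x a ih =>
    refine .head (b := ⟨some (.rewind k), s.setCol (some x), contents i o (x :: c) a⟩) ?_ ?_
    · simp [program, State.setCol, State.column]
    · simpa [State.setCol] using ih (s.setCol (some x)) (x :: c)

/-- The four entries of a row of the new matrix that replace an entry of the old one. -/
def block (k : Fin 4) (x : Column) : List (Option Bool ⊕ Unit) :=
  (List.finRange 4).map fun j => Sum.inl (some (x.bit k j))

theorem runs_emit (k : Fin 4) (s : State) (i : List (Option Bool))
    (o : List (Option Bool ⊕ Unit)) (c a : List Column) :
    Runs (c.length + 1) ⟨some (.emit k), s, contents i o c a⟩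
      ⟨some (.rewind k.castSucc), s.setCol none,
        contents i (c.reverse.flatMap (block k) ++ o) [] (c.reverse ++ a)⟩ := by
  induction c generalizing s o a with
  | nil =>
    refine .single ?_
    simp [program, State.setCol]
  | cons x c ih =>
    refine .head (b := ⟨some (.emit k), s.setCol (some x), contents i (block k x ++ o) c (x :: a)⟩)
      ?_ ?_
    · simp [program, State.setCol, State.column, block, List.finRange_succ]
    · simpa [State.setCol] using ih (s.setCol (some x)) (block k x ++ o) (x :: a)

/-- A row of the new matrix. -/
def rowText (c : List Column) (k : Fin 4) : List (Option Bool ⊕ Unit) :=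
  c.reverse.flatMap (block k) ++ [Sum.inl none]

theorem runs_emit_rewind (k : Fin 4) (s : State) (i : List (Option Bool))
    (o : List (Option Bool ⊕ Unit)) (c : List Column) :
    Runs (2 * c.length + 2) ⟨some (.emit k), s, contents i (Sum.inl none :: o) c []⟩
      ⟨some (afterRewindLabel k.castSucc), s.setCol none,
        contents i (afterRewindOutput k.castSucc (rowText c k ++ o)) c []⟩ := by
  have h₁ := runs_emit k s i (Sum.inl none :: o) c []
  have h₂ := runs_rewind k.castSucc (s.setCol none) i
    (c.reverse.flatMap (block k) ++ Sum.inl none :: o) [] (c.reverse ++ [])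
  convert! h₁.trans h₂ using 1
  · simp; omega
  · simp [State.setCol, rowText]

/-- The count is one rewinding, c + 1 steps, followed by four rounds of emitting and rewinding, 2c +
2 steps each. Rows 3, 2, 1, 0 are written in this order because the output is a stack. -/
theorem runs_rows (s : State) (i : List (Option Bool))
    (o : List (Option Bool ⊕ Unit)) (c a : List Column) (ha : a.reverse = c) :
    Runs (9 * c.length + 9) ⟨some (.rewind 4), s, contents i o [] a⟩
      ⟨some .next, s.setCol none, contents i ((List.finRange 4).flatMap (rowText c) ++ o) c []⟩ := by
  subst ha
  have h := runs_rewind 4 s i o [] a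
  have h₃ := runs_emit_rewind 3 (s.setCol none) i o a.reverse
  have h₂ := runs_emit_rewind 2 (s.setCol none) i (rowText a.reverse 3 ++ o) a.reverse
  have h₁ := runs_emit_rewind 1 (s.setCol none) i
    (rowText a.reverse 2 ++ (rowText a.reverse 3 ++ o)) a.reverse
  have h₀ := runs_emit_rewind 0 (s.setCol none) i
    (rowText a.reverse 1 ++ (rowText a.reverse 2 ++ (rowText a.reverse 3 ++ o))) a.reverse
  rw [List.append_nil] at h
  convert! (((h.trans h₃).trans h₂).trans h₁).trans h₀ using 1
  · simp; omega
  · simp [State.setCol, afterRewindLabel, afterRewindOutput, List.finRange_succ]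

/-- The alternatives in `hc` are the first row read, before any columns are recorded, and all later
rows. The hypothesis on `rest` says that the row really ends after `bs`. -/
theorem runs_read (s : State) (bs : List Bool) (rest : List (Option Bool))
    (hrest : rest.head?.join = none) (o : List (Option Bool ⊕ Unit)) (c a : List Column)
    (hc : c = [] ∨ c.length = bs.length) :
    ∃ s', Runs (bs.length + 1) ⟨some .read, s, contents (bs.map some ++ rest) o c a⟩
      ⟨some (.rewind 4), s', contents rest (List.replicate (bs.length - c.length) (Sum.inr ()) ++ o) []
        ((scan s.row s.seen bs c).reverse ++ a)⟩ := by
  induction bs generalizing s o c a with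
  | nil =>
    obtain rfl : c = [] := by simpa using hc
    refine ⟨{ s with inp := rest.head? }, .single ?_⟩
    simp [program, scan, hrest]
  | cons b bs ih =>
    cases c with
    | nil =>
      obtain ⟨s', hs'⟩ := ih (State.update ⟨some (some b), none, s.row, s.seen⟩) (Sum.inr () :: o)
        [] (Column.update s.row s.seen b Column.fresh :: a) (.inl rfl)
      refine ⟨s', .head (b := ⟨some .read, State.update ⟨some (some b), none, s.row, s.seen⟩,
        contents (bs.map some ++ rest) (Sum.inr () :: o) []
          (Column.update s.row s.seen b Column.fresh :: a)⟩) ?_ ?_⟩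
      · simp [program, State.setCol, State.update, State.column]
      · convert! hs' using 2
        simp [scan, State.update, List.replicate_succ']
    | cons x c =>
      obtain ⟨s', hs'⟩ := ih (State.update ⟨some (some b), some x, s.row, s.seen⟩) o
        c (Column.update s.row s.seen b x :: a) (.inr (by simpa using hc))
      refine ⟨s', .head (b := ⟨some .read, State.update ⟨some (some b), some x, s.row, s.seen⟩,
        contents (bs.map some ++ rest) o c (Column.update s.row s.seen b x :: a)⟩) ?_ ?_⟩
      · simp [program, State.setCol, State.update, State.column]
      · convert! hs' using 2
        simp [scan, State.update]

theorem runs_next (s : State) (bs : List Bool) (rest : List (Option Bool))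
    (hrest : rest.head?.join = none) (o : List (Option Bool ⊕ Unit)) (c : List Column)
    (hc : c = [] ∨ c.length = bs.length) :
    ∃ s', Runs (10 * bs.length + 11) ⟨some .next, s, contents (none :: bs.map some ++ rest) o c []⟩
      ⟨some .next, s', contents rest ((List.finRange 4).flatMap (rowText (scan 0 false bs c)) ++
        (List.replicate (bs.length - c.length) (Sum.inr ()) ++ o)) (scan 0 false bs c) []⟩ := by
  obtain ⟨s', hs'⟩ := runs_read ⟨some none, none, 0, false⟩ bs rest hrest o c [] hc
  have h₂ := runs_rows s' rest (List.replicate (bs.length - c.length) (Sum.inr ()) ++ o)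
    (scan 0 false bs c) ((scan 0 false bs c).reverse ++ []) (by simp)
  rw [length_scan] at h₂
  refine ⟨s'.setCol none, ?_⟩
  convert! (ReachesIn.head (b := (⟨some .read, ⟨some none, none, 0, false⟩,
    contents (bs.map some ++ rest) o c []⟩ : TM2.Cfg Γ Label State)) ?_ hs').trans h₂ using 1
  · omega
  · simp [program]

theorem runs_clear (s : State) (o : List (Option Bool ⊕ Unit)) (c : List Column) :
    Runs (c.length + 1) ⟨some .clear, s, contents [] o c []⟩
      ⟨none, State.init, contents [] o [] []⟩ := by
  induction c generalizing s with
  | nil => exact .single (by simp [program, State.setCol])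
  | cons x c ih =>
    exact .head (b := ⟨some .clear, s.setCol (some x), contents [] o c []⟩)
      (by simp [program, State.setCol]) (ih _)

/-! ### Matrices -/

variable (A : ℕ → ℕ → Bool) (n : ℕ)

/-- The number of set entries `(v, u)` with `w ≤ u < n`. -/
def rank (v w : ℕ) : ℕ := ((Finset.Ico w n).filter fun u => A v u = true).card

theorem rank_of_lt {w : ℕ} (hw : w < n) (v : ℕ) :
    rank A n v w = rank A n v (w + 1) + (A v w).toNat := by
  have : Finset.Ico w n = insert w (Finset.Ico (w + 1) n) := by ext; simp; omega
  rw [rank, this, Finset.filter_insert, rank]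
  cases h : A v w <;> simp

theorem rank_self (v : ℕ) : rank A n v n = 0 := by simp [rank]

/-- The number of set entries `(v, u)` with `w ≤ u < n`, modulo `4`. -/
def rank4 (v w : ℕ) : Fin 4 := Fin.ofNat 4 (rank A n v w)

theorem rank4_of_lt {w : ℕ} (hw : w < n) (v : ℕ) :
    rank4 A n v w = rank4 A n v (w + 1) + bitNum (A v w) := by
  rw [rank4, rank4, rank_of_lt A n hw]
  cases A v w <;> simp [bitNum, Fin.ext_iff, Fin.val_add]

/-- The state of the column `w` after reading the row `v`. -/
def colAt (v w : ℕ) : Column :=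
  ⟨A v w, decide (v = w), decide (v ≤ w), rank4 A n v w, rank4 A n w v⟩

/-- The numbers below `n`, in decreasing order. -/
abbrev desc (n : ℕ) : List ℕ := (List.range n).reverse

theorem desc_succ (n : ℕ) : desc (n + 1) = n :: desc n := by
  simp [desc, List.range_succ]

/-- The states of the columns `k - 1, …, 0` after reading all rows with numbers at least `v`. -/
def columns (v k : ℕ) : List Column := if v < n then (desc k).map (colAt A n v) else []

/-- Invariant of reading row v down to column k: the counter holds the entries at positions k and
above, and the diagonal has been seen exactly if k ≤ v. Symmetry turns counts along a column into
ranks along a row. -/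
theorem scan_columns (hA : ∀ v w, A v w = A w v) {v k : ℕ} (hv : v < n) (hk : k ≤ n) :
    scan (rank4 A n v k) (decide (k ≤ v)) ((desc k).map (A v)) (columns A n (v + 1) k) =
      (desc k).map (colAt A n v) := by
  induction k with
  | zero => rfl
  | succ k ih =>
    have hc : ∃ c : Column, (columns A n (v + 1) (k + 1)).head?.getD Column.fresh = c ∧
        c.passed = decide (v + 1 ≤ k) ∧ c.col = rank4 A n k (v + 1) ∧
        (columns A n (v + 1) (k + 1)).tail = columns A n (v + 1) k := by
      refine ⟨_, rfl, ?_⟩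
      -- For the first row read, v = n - 1, the fresh column has the right values: nothing passed
      -- and count zero.
      by_cases hvn : v + 1 < n
      · simp [columns, hvn, desc_succ, colAt]
      · obtain rfl : n = v + 1 := by omega
        simp [columns, Column.fresh, rank4, rank_self]
        omega
    obtain ⟨c, h₁, h₂, h₃, h₄⟩ := hc
    have hu : c.update (rank4 A n v (k + 1)) (decide (k + 1 ≤ v)) (A v k) = colAt A n v k := by
      -- Neither k > v (column already passed) nor k < v (diagonal already seen in this row) leaves
      -- k = v.
      have hd : (!decide (v + 1 ≤ k) && !decide (k + 1 ≤ v)) = decide (v = k) := by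
        rw [Bool.eq_iff_iff]; simp; omega
      have hp : (decide (v + 1 ≤ k) || decide (v = k)) = decide (v ≤ k) := by
        rw [Bool.eq_iff_iff]; simp; omega
      rw [Column.update, h₂, h₃, hd, hp, ← rank4_of_lt A n hk, hA v k, ← rank4_of_lt A n hv, hA k v]
      rfl
    have hs : (decide (k + 1 ≤ v) || decide (v = k)) = decide (k ≤ v) := by
      rw [Bool.eq_iff_iff]; simp; omega
    simp only [desc_succ, List.map_cons, scan] at h₁ h₄ ⊢
    rw [h₁, h₄, hu]
    change colAt A n v k :: scan (rank4 A n v k) (decide (k + 1 ≤ v) || decide (v = k)) _ _ = _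
    rw [hs, ih (by omega)]

/-- The text that describes the matrix of size `n`. -/
def matrixText : List (Option Bool) :=
  (List.range n).flatMap fun v => (List.range n).map (fun w => some (A v w)) ++ [none]

/-- The rows of the new matrix that stem from the rows of the old one with numbers below `m`. -/
def newText (m : ℕ) : List (Option Bool ⊕ Unit) :=
  (List.range m).flatMap fun v =>
    (List.finRange 4).flatMap (rowText ((desc n).map (colAt A n v)))

/-- The rows with numbers `m - 1, …, 0` in reverse. -/
def reversedRows (m : ℕ) : List (Option Bool) :=
  (desc m).flatMap fun v => none :: ((desc n).map (A v)).map some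

theorem matrixText_reverse : (matrixText A n).reverse = reversedRows A n n := by
  simp [matrixText, reversedRows, List.reverse_flatMap, Function.comp_def]

theorem length_reversedRows (m : ℕ) : (reversedRows A n m).length = m * (n + 1) := by
  induction m with
  | zero => simp [reversedRows]
  | succ m ih =>
    simp only [reversedRows, desc_succ, List.flatMap_cons, List.length_append] at ih ⊢
    rw [ih]
    simp
    ring

theorem length_columns (m : ℕ) :
    columns A n m n = [] ∨ (columns A n m n).length = n := by
  unfold columns
  split_ifs <;> simp

/-- Induction on the number m of rows still to be read. The difference `n - (columns A n m
n).length` counts the unary marks still to be written: n before the first row, none afterwards. -/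
theorem runs_from_next (hA : ∀ v w, A v w = A w v) (m : ℕ) (hm : m ≤ n) (s : State)
    (o : List (Option Bool ⊕ Unit)) :
    ∃ t, t ≤ m * (10 * n + 11) + n + 2 ∧
      Runs t ⟨some .next, s, contents (reversedRows A n m) o (columns A n m n) []⟩
      ⟨none, State.init, contents [] (newText A n m ++
        (List.replicate (n - (columns A n m n).length) (Sum.inr ()) ++ o)) [] []⟩ := by
  induction m generalizing s o with
  | zero =>
    have hlen : (columns A n 0 n).length = n := by
      unfold columns
      split_ifs with h
      · simp
      · simp; omega
    refine ⟨(columns A n 0 n).length + 1 + 1, by omega,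
      .head (b := ⟨some .clear, State.init, contents [] o (columns A n 0 n) []⟩) ?_ ?_⟩
    · have h0 : reversedRows A n 0 = [] := rfl
      simp [program, h0, State.init]
    · simpa [newText, hlen] using runs_clear State.init o (columns A n 0 n)
  | succ m ih =>
    have hscan := scan_columns A n hA (v := m) (k := n) (by omega) le_rfl
    have h0 : decide (n ≤ m) = false := by simp; omega
    have hcol : columns A n m n = (desc n).map (colAt A n m) := if_pos (by omega)
    have hlen : ((desc n).map (A m)).length = n := by simp
    rw [h0, rank4, rank_self] at hscan
    obtain ⟨s', hs'⟩ := runs_next s ((desc n).map (A m)) (reversedRows A n m) (by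
      cases m with
      | zero => rfl
      | succ m => simp [reversedRows, desc_succ]) o (columns A n (m + 1) n) (by
        rw [hlen]; exact length_columns A n (m + 1))
    change scan 0 false _ _ = _ at hscan
    rw [hscan, hlen] at hs'
    obtain ⟨t, ht, hr⟩ := ih (by omega) s' ((List.finRange 4).flatMap
      (rowText ((desc n).map (colAt A n m))) ++
        (List.replicate (n - (columns A n (m + 1) n).length) (Sum.inr ()) ++ o))
    rw [hcol] at hr
    refine ⟨10 * n + 11 + t, by rw [Nat.add_mul m 1]; omega, ?_⟩
    have hin : reversedRows A n (m + 1) =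
        none :: ((desc n).map (A m)).map some ++ reversedRows A n m := by
      simp [reversedRows, desc_succ]
    rw [hin]
    convert! hs'.trans hr using 3
    simp [newText, List.range_succ]

theorem initList_machine (w : List (Option Bool)) :
    initList machine w = ⟨some .next, State.init, contents w [] [] []⟩ := by
  have h : (initList machine w).stk = contents w [] [] [] := by
    funext k
    cases k <;> rfl
  exact congrArg (fun S => (⟨some .next, State.init, S⟩ : TM2.Cfg Γ Label State)) h

theorem haltList_machine (w : List (Option Bool ⊕ Unit)) :
    haltList machine w = ⟨none, State.init, contents [] w [] []⟩ := by
  have h : (haltList machine w).stk = contents [] w [] [] := by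
    funext k
    cases k <;> rfl
  exact congrArg (fun S => (⟨none, State.init, S⟩ : TM2.Cfg Γ Label State)) h

/-- The machine turns the reversed description of a symmetric matrix into the rows of the new matrix,
followed by the size of the old one in unary. -/
theorem machine_reachesIn (hA : ∀ v w, A v w = A w v) :
    ∃ t, t ≤ 11 * (matrixText A n).length + 2 + (matrixText A n).length ∧
      ReachesIn machine.step t (initList machine (matrixText A n).reverse)
        (haltList machine (newText A n n ++ List.replicate n (Sum.inr ()))) := by
  obtain ⟨t, ht, h⟩ := runs_from_next A n hA n le_rfl State.init []
  have hcol : columns A n n n = [] := if_neg (lt_irrefl n)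
  refine ⟨t, ?_, ?_⟩
  · rw [← List.length_reverse, matrixText_reverse, length_reversedRows]
    -- The text has n(n + 1) symbols, and n(10n + 11) + n + 2 ≤ 12n(n + 1) + 2.
    nlinarith
  · rw [hcol] at h
    refine (congrArg₂ (ReachesIn machine.step t) (initList_machine _) (haltList_machine _)).mpr ?_
    rw [matrixText_reverse]
    rw [List.append_nil] at h
    exact h

end TriangleMachine

/-! ### The reduction -/

namespace FinGraph

open TriangleMachine

open Classical in
/-- The adjacency matrix, extended by `false`. -/
noncomputable def entry (G : FinGraph) (v w : ℕ) : Bool :=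
  decide (∃ (hv : v < G.n) (hw : w < G.n), G.graph.Adj ⟨v, hv⟩ ⟨w, hw⟩)

theorem entry_symm (G : FinGraph) (v w : ℕ) : G.entry v w = G.entry w v := by
  rw [entry, entry, decide_eq_decide]
  exact ⟨fun ⟨h, h', h''⟩ => ⟨h', h, h''.symm⟩, fun ⟨h, h', h''⟩ => ⟨h', h, h''.symm⟩⟩

theorem entry_eq_true (G : FinGraph) (v w : Fin G.n) :
    G.entry v w = true ↔ G.graph.Adj v w := by
  simp [entry]

theorem encode_eq_matrixText (G : FinGraph) : G.encode = matrixText G.entry G.n := by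
  classical
  rw [matrixText, ← List.map_coe_finRange_eq_range, encode, List.flatMap_map]
  congr 1
  funext i
  rw [encodeRow, List.map_map]
  congr 2
  funext j
  simp [entry]

/-- The neighbours of a vertex of a 3-regular graph, numbered in decreasing order. -/
noncomputable def numbering (G : FinGraph) (v u : Fin G.n) : Fin 4 := rank4 G.entry G.n v u

/-- The triangle graph of a finite graph. -/
noncomputable def triangle (G : FinGraph) : FinGraph where
  n := G.n * 4
  graph := (G.graph.triangleGraph G.numbering).comap finProdFinEquiv.symm

/-- `finProdFinEquiv` places `(v, i)` at position i + 4v, so the four vertices stemming from v are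
consecutive and each old entry becomes a 4 × 4 block. The record `colAt` contains both numbers on
which that block depends. -/
theorem entry_triangle (G : FinGraph) (v w : Fin G.n) (i j : Fin 4) :
    G.triangle.entry (i + 4 * v) (j + 4 * w) = (colAt G.entry G.n v w).bit i j := by
  have h : ∀ (v : Fin G.n) (i : Fin 4),
      ((i : ℕ) + 4 * v) = ((finProdFinEquiv (v, i) : Fin (G.n * 4)) : ℕ) := fun _ _ => rfl
  rw [h, h, Bool.eq_iff_iff]
  refine (G.triangle.entry_eq_true _ _).trans ?_
  simp only [triangle, SimpleGraph.comap_adj, Equiv.symm_apply_apply, SimpleGraph.triangleGraph,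
    ← entry_eq_true, Column.bit_eq_true, colAt, numbering, decide_eq_true_eq,
    Fin.ext_iff (a := v)]

theorem range_mul_four (n : ℕ) : List.range (n * 4) =
    (List.range n).flatMap fun v => (List.finRange 4).map fun i : Fin 4 => (i : ℕ) + 4 * v := by
  induction n with
  | zero => rfl
  | succ n ih =>
    rw [Nat.add_mul, List.range_add, ih, List.range_succ (n := n), List.flatMap_append]
    simp [List.range_succ, List.finRange_succ, Nat.mul_comm n, Nat.add_comm]

theorem encode_triangle (G : FinGraph) :
    G.triangle.encode.map Sum.inl = newText G.entry G.n G.n := by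
  rw [encode_eq_matrixText, matrixText, newText]
  change List.map _ ((List.range (G.n * 4)).flatMap fun v =>
    (List.range (G.n * 4)).map _ ++ [none]) = _
  rw [range_mul_four, List.flatMap_assoc, List.map_flatMap]
  refine List.flatMap_congr fun v hv => ?_
  rw [List.flatMap_map, List.map_flatMap]
  refine List.flatMap_congr fun i _ => ?_
  rw [rowText, List.map_append, ← List.map_reverse, List.reverse_reverse, List.map_flatMap,
    List.flatMap_map, List.map_flatMap]
  congr 1
  refine List.flatMap_congr fun w hw => ?_
  simp only [block, List.map_map]
  refine List.map_congr_left fun j _ => ?_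
  have h := G.entry_triangle ⟨v, List.mem_range.1 hv⟩ ⟨w, List.mem_range.1 hw⟩ i j
  exact congrArg (fun b => Sum.inl (some b)) h

/-- Along the neighbours of v the rank decreases strictly and stays between 1 and 3. Nothing is lost
modulo 4, and three distinct values exhaust {1, 2, 3}. -/
theorem IsCubic.isNeighborNumbering {G : FinGraph} (hG : G.IsCubic) :
    G.graph.IsNeighborNumbering G.numbering := by
  classical
  have hcard : ∀ v, (G.graph.neighborFinset v).card = 3 := fun v => by
    have := hG v
    rw [← this, SimpleGraph.card_neighborFinset_eq_degree]
  have hlt : ∀ v w w' : Fin G.n, G.graph.Adj v w → w < w' →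
      rank G.entry G.n v w' < rank G.entry G.n v w := by
    intro v w w' h hw
    refine Finset.card_lt_card ⟨?_, fun hs => ?_⟩
    · exact Finset.filter_subset_filter _ (Finset.Ico_subset_Ico_left hw.le)
    · have : (w : ℕ) ∈ (Finset.Ico (w : ℕ) G.n).filter fun u => G.entry v u = true := by
        simpa [entry_eq_true] using h
      have := hs this
      simp only [Finset.mem_filter, Finset.mem_Ico] at this
      exact absurd this.1.1 (not_le.2 hw)
  have hle : ∀ v w : Fin G.n, rank G.entry G.n v w ≤ 3 := by
    intro v w
    rw [← hcard v, ← Finset.card_map Fin.valEmbedding]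
    refine Finset.card_le_card fun u hu => ?_
    simp only [Finset.mem_filter, Finset.mem_Ico] at hu
    simp only [Finset.mem_map, SimpleGraph.mem_neighborFinset]
    exact ⟨⟨u, hu.1.2⟩, (G.entry_eq_true v ⟨u, hu.1.2⟩).1 hu.2, rfl⟩
  have hpos : ∀ v w : Fin G.n, G.graph.Adj v w → 0 < rank G.entry G.n v w := by
    intro v w h
    refine Finset.card_pos.2 ⟨w, ?_⟩
    simpa [entry_eq_true] using h
  have hval : ∀ v w, (G.numbering v w : ℕ) = rank G.entry G.n v w := fun v w =>
    Nat.mod_eq_of_lt (by have := hle v w; omega)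
  have hne : ∀ v u, G.graph.Adj v u → G.numbering v u ≠ 0 := by
    intro v u h h0
    have := hpos v u h
    rw [← hval, h0] at this
    exact absurd this (lt_irrefl 0)
  have hinj : ∀ v u u', G.graph.Adj v u → G.graph.Adj v u' →
      G.numbering v u = G.numbering v u' → u = u' := by
    intro v u u' h h' he
    have he' : rank G.entry G.n v u = rank G.entry G.n v u' := by rw [← hval, ← hval, he]
    rcases lt_trichotomy u u' with hu | hu | hu
    · have := hlt v u u' h hu; omega
    · exact hu
    · have := hlt v u' u h' hu; omega
  refine ⟨hne, hinj, fun v i hi => ?_⟩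
  have hsurj := Finset.surjOn_of_injOn_of_card_le (s := G.graph.neighborFinset v)
    (t := Finset.univ.erase (0 : Fin 4)) (G.numbering v)
    (fun u hu => by simpa using hne v u (by simpa using hu))
    (fun u hu u' hu' => hinj v u u' (by simpa using hu) (by simpa using hu'))
    (by rw [hcard]; decide)
  obtain ⟨u, hu, rfl⟩ := hsurj (by simpa using hi : i ∈ _)
  exact ⟨u, by simpa using hu, rfl⟩

theorem IsCubic.triangle {G : FinGraph} (hG : G.IsCubic) : G.triangle.IsCubic := by
  classical
  intro p
  have h := hG.isNeighborNumbering.ncard_neighborSet_triangleGraph (finProdFinEquiv.symm p)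
  rw [← SimpleGraph.card_neighborSet_eq_degree, ← Nat.card_eq_fintype_card, ← h]
  exact Nat.card_congr
    ((SimpleGraph.Iso.comap finProdFinEquiv.symm (G.graph.triangleGraph G.numbering)).mapNeighborSet
      p)

theorem IsCubic.minEdgeDeletionBipartition_triangle_le_iff {G : FinGraph} (hG : G.IsCubic) :
    G.triangle.graph.minEdgeDeletionBipartition ≤ G.n ↔ G.graph.HasNAEDecomposition := by
  have h := hG.isNeighborNumbering
  have hcard : Nat.card (Fin G.n) = G.n := Nat.card_fin _
  have heq : G.triangle.graph.minEdgeDeletionBipartition =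
      (G.graph.triangleGraph G.numbering).minEdgeDeletionBipartition :=
    SimpleGraph.minEdgeDeletionBipartition_congr
      (SimpleGraph.Iso.comap finProdFinEquiv.symm (G.graph.triangleGraph G.numbering))
  rw [heq]
  constructor
  · intro hle
    exact h.hasNAEDecomposition_of_le (by rwa [hcard])
  · intro hle
    exact (h.le_of_hasNAEDecomposition hle).trans_eq hcard

end FinGraph

/-- The reduction: a 3-regular graph is mapped to its triangle graph and its number of vertices. -/
noncomputable def triangleReduction (G : cubicBipartiteNAEDecomposition.Inst) :
    cubicMinEdgeDeletionBipartition.Inst :=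
  (⟨G.1.triangle, G.2.1.triangle⟩, G.1.n)

/-- The triangle graph is written down in polynomial time from the reversed adjacency matrix. -/
noncomputable def triangleReductionComputableInPolyTime :
    TM2ComputableInPolyTime (fun G => (cubicBipartiteNAEDecomposition.encode G).reverse)
      cubicMinEdgeDeletionBipartition.encode triangleReduction where
  tm := TriangleMachine.machine
  inputAlphabet := Equiv.refl _
  outputAlphabet := Equiv.refl _
  time := Polynomial.C 12 * Polynomial.X + Polynomial.C 2
  outputsFun G := Nonempty.some <| by
    obtain ⟨t, ht, h⟩ := TriangleMachine.machine_reachesIn G.1.entry G.1.n G.1.entry_symm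
    rw [← FinGraph.encode_eq_matrixText] at h ht
    have hin : (cubicBipartiteNAEDecomposition.encode G).reverse.map
        (Equiv.refl (Option Bool)).invFun = G.1.encode.reverse := List.map_id _
    have hout : (cubicMinEdgeDeletionBipartition.encode (triangleReduction G)).map
        (Equiv.refl (Option Bool ⊕ Unit)).invFun =
        TriangleMachine.newText G.1.entry G.1.n G.1.n ++ List.replicate G.1.n (Sum.inr ()) := by
      rw [← FinGraph.encode_triangle]
      exact List.map_id _
    have h' := (congrArg₂ (fun a b => ReachesIn TriangleMachine.machine.step t
      (initList TriangleMachine.machine a) (haltList TriangleMachine.machine b)) hin hout).mpr h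
    refine ⟨⟨⟨t, ReachesIn.iff_iterate.1 h'⟩, ?_⟩⟩
    refine ht.trans (le_of_eq ?_)
    simp only [Polynomial.eval_add, Polynomial.eval_mul, Polynomial.eval_C, Polynomial.eval_X,
      List.length_reverse]
    change 11 * G.1.encode.length + 2 + G.1.encode.length = 12 * G.1.encode.length + 2
    omega

theorem theorem4 (h : cubicBipartiteNAEDecomposition.NPComplete) :
    cubicMinEdgeDeletionBipartition.NPHard := by
  intro L hL
  obtain ⟨f, ⟨hf⟩, hfL⟩ := h.2 L hL
  have : Finite cubicBipartiteNAEDecomposition.Alphabet :=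
    cubicBipartiteNAEDecomposition.finAlphabet
  have : Nonempty cubicBipartiteNAEDecomposition.Alphabet := ⟨(none : Option Bool)⟩
  refine ⟨triangleReduction ∘ f, hf.comp_of_reverse triangleReductionComputableInPolyTime,
    fun x => (hfL x).trans ?_⟩
  exact (f x).2.1.minEdgeDeletionBipartition_triangle_le_iff.symm
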